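/- Let $\kappa\in\mathbb R$, $\kappa\neq 0$. For functions $F,f$ on $\mathbb C=\mathbb R^2$ with $f$ Schwartz and $F$ measurable of polynomial growth, let $$(F\star f)(w)=\Big(\frac{2}{\pi\kappa}\Big)^2\int_{\mathbb C}d^2s\int_{\mathbb C}d^2t\;F(w+s)\,f(w+t)\,e^{-\frac{4i}{\kappa}\operatorname{Im}(s^*t)}$$ be the Moyal product (iterated integral). Left Moyal multiplications by the coordinate functions $z$ and $z^*$ are operators on $\mathcal S(\mathbb R^2)$, again denoted $z$, $z^*$ (they satisfy $z^*z-zz^*=\kappa$); put $a=zz^*$, $b=z^2$, $b^*=(z^*)^2$ (products of operators), acting diagonally on $\mathcal S(\mathbb R^2)\otimes\mathbb C^2\subset L^2(\mathbb R^2)\otimes\mathbb C^2$. Let $$D=\begin{pmatrix}0&\partial_z\\ \partial_{z^*}&0\end{pmatrix},\qquad \gamma=\begin{pmatrix}1&0\\0&-1\end{pmatrix},\qquad \rho(\psi_1,\psi_2)(z)=(\psi_1(-z),-\psi_2(-z)),$$ where $\partial_z=\frac12(\partial_x-i\partial_y)$ and $\partial_{z^*}=\frac12(\partial_x+i\partial_y)$.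 The operators $D,\gamma,a,b,b^*$ commute with the $\mathbb Z_2$-action $\rho$. For $\varepsilon=\pm1$ let $\mathcal H_\varepsilon$ be the $\varepsilon$-eigenspace of $\rho$ in $L^2(\mathbb R^2)\otimes\mathbb C^2$ (the Hilbert space of the restricted spectral triple of the $\mathbb Z_2$ Moyal cone), and $\mathcal S_\varepsilon$ the $\varepsilon$-eigenspace of $\rho$ in $\mathcal S(\mathbb R^2)\otimes\mathbb C^2$. Then $\mathcal S_\varepsilon$ is dense in $\mathcal H_\varepsilon$, and on $\mathcal S_\varepsilon$ the following identity of operators holds: $$-[D,b^*]a[D,b]-2a[D,b][D,b^*]+\tfrac32a[D,b^*][D,b]+3b[D,a][D,b^*]-b[D,b^*][D,a]+b^*[D,b][D,a]=4\kappa^2\gamma.$$ -/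

import Mathlib

open scoped SchwartzMap FourierTransform LineDeriv ComplexConjugate

noncomputable section

namespace MoyalCone

/-- The Moyal product on the plane `ℂ = ℝ²`, as an iterated oscillating integral, normalised so
that `z⋆ * z - z * z⋆ = κ` and `1 * f = f`:
`(F * f)(w) = (2 / (π κ))² ∫ d²s ∫ d²t F(w + s) f(w + t) exp(-(4 i / κ) Im(s⋆ t))`.
If `f` is a Schwartz function, the inner integral is a Schwartz function of `s`, so that `F` may
be any measurable function of polynomial growth. -/
def moyal (κ : ℝ) (F f : ℂ → ℂ) (w : ℂ) : ℂ :=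
  ((2 / (Real.pi * κ)) ^ 2 : ℝ) *
    ∫ s : ℂ, ∫ t : ℂ, F (w + s) * f (w + t) *
      Complex.exp (-(4 * Complex.I / κ) * ((conj s * t).im : ℝ))

theorem moyal_inner (κ : ℝ) (f : 𝓢(ℂ, ℂ)) (w s c : ℂ) :
    (∫ t : ℂ, c * f (w + t) * Complex.exp (-(4 * Complex.I / κ) * ((conj s * t).im : ℝ))) =
      c * (Complex.exp (((2 * Real.pi * inner ℝ ((2 / (Real.pi * κ)) • (Complex.I * s)) w : ℝ) : ℂ)
        * Complex.I) * (𝓕 f) ((2 / (Real.pi * κ)) • (Complex.I * s))) := by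
  rw [← MeasureTheory.integral_add_left_eq_self (μ := MeasureTheory.volume) _ (-w),
    SchwartzMap.fourier_coe, Real.fourier_eq', ← MeasureTheory.integral_const_mul,
    ← MeasureTheory.integral_const_mul]
  congr 1
  ext v
  rw [smul_eq_mul, ← mul_assoc (Complex.exp _), ← Complex.exp_add, add_neg_cancel_left, mul_assoc,
    mul_comm (f v)]
  congr 3
  simp only [Complex.inner, Complex.real_smul, map_mul, Complex.conj_ofReal, Complex.conj_I,
    Complex.mul_im, Complex.mul_re, Complex.ofReal_re, Complex.ofReal_im, Complex.I_re,
    Complex.I_im, Complex.conj_re, Complex.conj_im, Complex.add_re, Complex.add_im, Complex.neg_re,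
    Complex.neg_im]
  push_cast
  have := Complex.ofReal_ne_zero.2 Real.pi_ne_zero
  by_cases h : (κ : ℂ) = 0
  · simp [h]
  field_simp
  ring

theorem integral_I_mul (H : ℂ → ℂ) : ∫ x : ℂ, H (Complex.I * x) = ∫ x : ℂ, H x := by
  have h := (rotation ⟨Complex.I, by simp [Submonoid.unitSphere]⟩).measurePreserving
  exact h.integral_comp (rotation _).toHomeomorph.measurableEmbedding H

theorem moyal_linear {κ : ℝ} (hκ : κ ≠ 0) (F : ℂ →L[ℝ] ℂ) (f : 𝓢(ℂ, ℂ)) :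
    moyal κ F f = ⇑(SchwartzMap.smulLeftCLM ℂ F f + ((κ : ℂ) / (4 * Complex.I)) •
      (F 1 • ∂_{Complex.I} f - F Complex.I • ∂_{(1 : ℂ)} f)) := by
  have hF : (F : ℂ → ℂ).HasTemperateGrowth := F.hasTemperateGrowth
  have hpi := Complex.ofReal_ne_zero.2 Real.pi_ne_zero
  have hκ' : (κ : ℂ) ≠ 0 := by exact_mod_cast hκ
  ext w
  set g : 𝓢(ℂ, ℂ) := F w • f + ((κ : ℂ) / (4 * Complex.I)) •
      (F 1 • ∂_{Complex.I} f + (-F Complex.I) • ∂_{(1 : ℂ)} f) with hg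
  have hgw : (SchwartzMap.smulLeftCLM ℂ F f + ((κ : ℂ) / (4 * Complex.I)) •
      (F 1 • ∂_{Complex.I} f - F Complex.I • ∂_{(1 : ℂ)} f)) w = (𝓕⁻ (𝓕 g)) w := by
    rw [FourierTransform.fourierInv_fourier_eq, hg]
    simp [SchwartzMap.smulLeftCLM_apply_apply hF, sub_eq_add_neg]
  rw [hgw, SchwartzMap.fourierInv_coe, Real.fourierInv_eq', moyal]
  simp only [moyal_inner]
  set R : ℝ := 2 / (Real.pi * κ) with hR
  have hR0 : R ≠ 0 := by rw [hR]; have := Real.pi_ne_zero; positivity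
  set H : ℂ → ℂ := fun v => Complex.exp (((2 * Real.pi * inner ℝ v w : ℝ) : ℂ) * Complex.I) •
    (𝓕 g) v with hH
  have key : ∀ s : ℂ, F (w + s) * (Complex.exp (((2 * Real.pi *
      inner ℝ (R • (Complex.I * s)) w : ℝ) : ℂ) * Complex.I) * (𝓕 f) (R • (Complex.I * s))) =
      (fun x => H (Complex.I * x)) (R • s) := by
    intro s
    have hFs : F s = s.re * F 1 + s.im * F Complex.I := by
      conv_lhs => rw [← Complex.re_add_im s]
      have h1 := F.map_smul s.re 1
      have h2 := F.map_smul s.im Complex.I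
      simp only [Complex.real_smul, mul_one] at h1 h2
      rw [map_add, h1, h2]
    simp only [hH, hg, FourierTransform.fourier_add, FourierTransform.fourier_smul,
      SchwartzMap.fourier_lineDerivOp_eq]
    have e : Complex.I * R • s = R • (Complex.I * s) := by
      simp only [Complex.real_smul]; ring
    have t1 : ∀ m : ℂ, (fun x : ℂ => (inner ℝ x m : ℝ)).HasTemperateGrowth := by
      intro m; fun_prop
    rw [e]
    simp only [add_apply, smul_apply,
      SchwartzMap.smulLeftCLM_apply_apply (t1 _), map_add, hFs, smul_eq_mul]
    generalize (𝓕 f) (R • (Complex.I * s)) = q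
    simp only [Complex.inner, Complex.real_smul, map_mul, Complex.conj_ofReal, Complex.conj_I,
      Complex.mul_im, Complex.mul_re, Complex.ofReal_re, Complex.ofReal_im, Complex.I_re,
      Complex.I_im, Complex.conj_re, Complex.conj_im, Complex.neg_re, Complex.neg_im,
      Complex.one_re, Complex.one_im]
    generalize Complex.exp _ = E
    rw [hR]
    push_cast
    have := Complex.I_sq
    field_simp
    ring
  rw [MeasureTheory.integral_congr_ae (Filter.Eventually.of_forall key)]
  have h1 := MeasureTheory.Measure.integral_comp_smul (MeasureTheory.volume : MeasureTheory.Measure ℂ)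
    (fun x => H (Complex.I * x)) R
  rw [integral_I_mul, Complex.finrank_real_complex, abs_of_nonneg (by positivity),
    Complex.real_smul] at h1
  refine (congrArg (fun x => ((R ^ 2 : ℝ) : ℂ) * x) h1).trans ?_
  rw [← mul_assoc, ← Complex.ofReal_mul, mul_inv_cancel₀ (by positivity), Complex.ofReal_one,
    one_mul]

/-- Left Moyal multiplication `f ↦ F * f` by a real-linear function `F : ℂ → ℂ`, as an operator on
the Schwartz space. -/
def leftMul (κ : ℝ) (hκ : κ ≠ 0) (F : ℂ →L[ℝ] ℂ) : Module.End ℂ 𝓢(ℂ, ℂ) where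
  toFun f :=
    { toFun := moyal κ F f
      smooth' := by rw [moyal_linear hκ]; exact SchwartzMap.smooth' _
      decay' := by rw [moyal_linear hκ]; exact SchwartzMap.decay' _ }
  map_add' f g := by
    apply DFunLike.coe_injective
    change moyal κ F ⇑(f + g) = moyal κ F f + moyal κ F g
    simp only [moyal_linear hκ]
    ext w
    simp [LineDeriv.lineDerivOp_add]
    ring
  map_smul' c f := by
    apply DFunLike.coe_injective
    change moyal κ F ⇑(c • f) = c • moyal κ F f
    simp only [moyal_linear hκ]
    ext w
    simp [LineDeriv.lineDerivOp_smul]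
    ring

/-- The coordinate `z` of the Moyal plane, acting by left Moyal multiplication. -/
def coordZ (κ : ℝ) (hκ : κ ≠ 0) : Module.End ℂ 𝓢(ℂ, ℂ) :=
  leftMul κ hκ (ContinuousLinearMap.id ℝ ℂ)

/-- The conjugate coordinate `z⋆` of the Moyal plane, acting by left Moyal multiplication. -/
def coordZStar (κ : ℝ) (hκ : κ ≠ 0) : Module.End ℂ 𝓢(ℂ, ℂ) :=
  leftMul κ hκ (Complex.conjCLE : ℂ →L[ℝ] ℂ)

/-- `∂_z = (∂_x - i ∂_y) / 2`. -/
def delZ : Module.End ℂ 𝓢(ℂ, ℂ) :=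
  (1 / 2 : ℂ) • ((LineDeriv.lineDerivOpCLM ℂ 𝓢(ℂ, ℂ) (1 : ℂ)).toLinearMap -
    Complex.I • (LineDeriv.lineDerivOpCLM ℂ 𝓢(ℂ, ℂ) Complex.I).toLinearMap)

/-- `∂_{z⋆} = (∂_x + i ∂_y) / 2`. -/
def delZStar : Module.End ℂ 𝓢(ℂ, ℂ) :=
  (1 / 2 : ℂ) • ((LineDeriv.lineDerivOpCLM ℂ 𝓢(ℂ, ℂ) (1 : ℂ)).toLinearMap +
    Complex.I • (LineDeriv.lineDerivOpCLM ℂ 𝓢(ℂ, ℂ) Complex.I).toLinearMap)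

/-- The action of the generator of `ℤ₂` on functions, `σ(f)(z) = f(e^{πi} z) = f(-z)`. -/
def sigma : Module.End ℂ 𝓢(ℂ, ℂ) :=
  (SchwartzMap.compCLMOfContinuousLinearEquiv ℂ (ContinuousLinearEquiv.neg ℝ)).toLinearMap

/-- Schwartz spinors `𝓢(ℝ²) ⊗ ℂ²`. -/
abbrev Spinor : Type := 𝓢(ℂ, ℂ) × 𝓢(ℂ, ℂ)

/-- The Dirac operator `D = (0, ∂_z; ∂_{z⋆}, 0)`. -/
def diracPlane : Module.End ℂ Spinor :=
  (delZ ∘ₗ LinearMap.snd ℂ _ _).prod (delZStar ∘ₗ LinearMap.fst ℂ _ _)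

/-- The chirality operator `γ = (1, 0; 0, -1)`. -/
def chiralityPlane : Module.End ℂ Spinor := LinearMap.prodMap 1 (-1)

/-- The diagonal action on spinors of an operator on functions. -/
def diag (T : Module.End ℂ 𝓢(ℂ, ℂ)) : Module.End ℂ Spinor := LinearMap.prodMap T T

/-- The lift of the `ℤ₂`-action to spinors, unique up to a sign, that commutes with `D` and `γ` and
implements `σ`. -/
def rho : Module.End ℂ Spinor := LinearMap.prodMap sigma (-sigma)

/-- The Schwartz spinors in the eigenspace of `ρ` with eigenvalue `ε`. For `ε = ±1` these are the
common dense domain of the operators of the spectral triple of the Moyal cone. -/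
def core (ε : ℂ) : Submodule ℂ Spinor := Module.End.eigenspace rho ε

/-- The restriction to `core ε` of an operator on spinors that commutes with the `ℤ₂`-action. -/
def onCore (ε : ℂ) (T : Module.End ℂ Spinor) (hT : Commute T rho) : Module.End ℂ (core ε) :=
  T.restrict fun ψ hψ => by
    rw [core, Module.End.mem_eigenspace_iff] at hψ ⊢
    have h := LinearMap.congr_fun hT.eq ψ
    simp only [Module.End.mul_apply] at h
    rw [← h, hψ, map_smul]

theorem lineDeriv_sigma (m : ℂ) (f : 𝓢(ℂ, ℂ)) : ∂_{m} (sigma f) = -sigma (∂_{m} f) := by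
  refine (SchwartzMap.lineDerivOp_compCLMOfContinuousLinearEquiv ℂ m
    (ContinuousLinearEquiv.neg ℝ) f).trans ?_
  ext w
  simp [sigma, SchwartzMap.lineDerivOp_apply_eq_fderiv]

theorem leftMul_sigma (κ : ℝ) (hκ : κ ≠ 0) (F : ℂ →L[ℝ] ℂ) :
    leftMul κ hκ F * sigma = -(sigma * leftMul κ hκ F) := by
  have hF : (F : ℂ → ℂ).HasTemperateGrowth := F.hasTemperateGrowth
  ext f w
  change moyal κ F (sigma f) w = -moyal κ F f (-w)
  simp only [moyal_linear hκ, lineDeriv_sigma]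
  simp [SchwartzMap.smulLeftCLM_apply_apply hF, sigma]
  ring

theorem diag_commute (κ : ℝ) (hκ : κ ≠ 0) (F G : ℂ →L[ℝ] ℂ) :
    Commute (diag (leftMul κ hκ F * leftMul κ hκ G)) rho := by
  have h : leftMul κ hκ F * leftMul κ hκ G * sigma = sigma * (leftMul κ hκ F * leftMul κ hκ G) := by
    rw [mul_assoc, leftMul_sigma, mul_neg, ← mul_assoc, leftMul_sigma]
    simp [mul_assoc]
  have h' := fun f => LinearMap.congr_fun h f
  simp only [Module.End.mul_apply] at h'
  refine LinearMap.ext fun ψ => Prod.ext ?_ ?_ <;> simp [diag, rho, h']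

theorem dirac_commute : Commute diracPlane rho := by
  refine LinearMap.ext fun ψ => Prod.ext ?_ ?_ <;>
  simp [diracPlane, rho, delZ, delZStar, lineDeriv_sigma] <;> module

theorem chirality_commute : Commute chiralityPlane rho := by
  refine LinearMap.ext fun ψ => Prod.ext ?_ ?_ <;> simp [chiralityPlane, rho]

/-- The Dirac operator of the Moyal cone. -/
def dirac (ε : ℂ) : Module.End ℂ (core ε) := onCore ε diracPlane dirac_commute

/-- The chirality operator of the Moyal cone. -/
def chirality (ε : ℂ) : Module.End ℂ (core ε) := onCore ε chiralityPlane chirality_commute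

/-- The generator `a = z z⋆` of the cone algebra, acting on spinors. -/
def genA (κ : ℝ) (hκ : κ ≠ 0) (ε : ℂ) : Module.End ℂ (core ε) :=
  onCore ε (diag (coordZ κ hκ * coordZStar κ hκ)) (diag_commute κ hκ _ _)

/-- The generator `b = z²` of the cone algebra, acting on spinors. -/
def genB (κ : ℝ) (hκ : κ ≠ 0) (ε : ℂ) : Module.End ℂ (core ε) :=
  onCore ε (diag (coordZ κ hκ * coordZ κ hκ)) (diag_commute κ hκ _ _)

/-- The generator `b⋆ = (z⋆)²` of the cone algebra, acting on spinors. -/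
def genBStar (κ : ℝ) (hκ : κ ≠ 0) (ε : ℂ) : Module.End ℂ (core ε) :=
  onCore ε (diag (coordZStar κ hκ * coordZStar κ hκ)) (diag_commute κ hκ _ _)

/-- `L²(ℝ²)`. -/
abbrev L2 : Type := MeasureTheory.Lp ℂ 2 (MeasureTheory.volume : MeasureTheory.Measure ℂ)

/-- The Hilbert space `L²(ℝ²) ⊗ ℂ²` of the Moyal plane. -/
abbrev HilbertPlane : Type := WithLp 2 (L2 × L2)

/-- The action of the generator of `ℤ₂` on `L²(ℝ²)`, `f(z) ↦ f(-z)`. -/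
def sigmaL2 : L2 →ₗ[ℂ] L2 :=
  (MeasureTheory.Lp.compMeasurePreservingₗᵢ ℂ Neg.neg
    (MeasureTheory.Measure.measurePreserving_neg MeasureTheory.volume)).toLinearMap

/-- The lift of the `ℤ₂`-action to the Hilbert space. -/
def rhoL2 : Module.End ℂ HilbertPlane :=
  (WithLp.linearEquiv 2 ℂ (L2 × L2)).symm.toLinearMap ∘ₗ
    LinearMap.prodMap sigmaL2 (-sigmaL2) ∘ₗ (WithLp.linearEquiv 2 ℂ (L2 × L2)).toLinearMap

/-- The Hilbert space of the Moyal cone: the eigenspace of `ρ` with eigenvalue `ε = ±1`. -/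
def hilbert (ε : ℂ) : Submodule ℂ HilbertPlane := Module.End.eigenspace rhoL2 ε

/-- The inclusion of Schwartz spinors into the Hilbert space. -/
def toHilbert : Spinor →ₗ[ℂ] HilbertPlane :=
  (WithLp.linearEquiv 2 ℂ (L2 × L2)).symm.toLinearMap ∘ₗ
    LinearMap.prodMap (SchwartzMap.toLpCLM ℂ ℂ 2 MeasureTheory.volume).toLinearMap
      (SchwartzMap.toLpCLM ℂ ℂ 2 MeasureTheory.volume).toLinearMap

end MoyalCone

end

open MoyalCone

/-!
A commutator with `D` is off-diagonal, so each of the six products is diagonal. The coordinates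
satisfy `[∂_z, z] = [∂_{z⋆}, z⋆] = 1` and `[∂_z, z⋆] = [∂_{z⋆}, z] = 0`, whence
`[D, a] = (0, z⋆; z, 0)`, `[D, b] = (0, 2z; 0, 0)` and `[D, b⋆] = (0, 0; 2z⋆, 0)`. The two diagonal
entries are then words of degree four in `z` and `z⋆`, which `z⋆ z - z z⋆ = κ` collapses to `4κ²`
and `-4κ²`. Density holds because `(1 + ε ρ) / 2` is a continuous projection of the plane onto the
cone that preserves Schwartz spinors.
-/

namespace MoyalCone

open Module LineDeriv

attribute [local instance] LieRing.ofAssociativeRing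

section Involution

variable {R V H : Type*} [CommRing R] [AddCommGroup V] [Module R V]

theorem add_smul_mem_eigenspace {r : End R V} (hr : r * r = 1) {ε : R} (hε : ε * ε = 1) (v : V) :
    v + ε • r v ∈ r.eigenspace ε := by
  have hrv : r (r v) = v := LinearMap.congr_fun hr v
  rw [End.mem_eigenspace_iff, map_add, map_smul, hrv, smul_add, smul_smul, hε, one_smul, add_comm]

theorem topologicalClosure_map_eigenspace [Invertible (2 : R)] [AddCommGroup H] [Module R H]
    [TopologicalSpace H] [T0Space H] [IsTopologicalAddGroup H] [ContinuousConstSMul R H]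
    {r : End R V} (hr : r * r = 1) {s : End R H} (hs : Continuous s)
    {ι : V →ₗ[R] H} (hι : DenseRange ι) (hsι : ∀ v, s (ι v) = ι (r v))
    {ε : R} (hε : ε * ε = 1) :
    ((r.eigenspace ε).map ι).topologicalClosure = s.eigenspace ε := by
  refine le_antisymm (Submodule.topologicalClosure_minimal _ ?_ ?_) fun x hx ↦ ?_
  · rintro _ ⟨v, hv, rfl⟩
    rw [End.mem_eigenspace_iff, hsι, End.mem_eigenspace_iff.mp hv, map_smul]
  · exact ContinuousLinearMap.isClosed_eigenspace ⟨s, hs⟩ ε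
  · have hfix : ⅟(2 : R) • (x + ε • s x) = x := by
      rw [End.mem_eigenspace_iff.mp hx, smul_smul, hε, one_smul, ← two_smul R, invOf_smul_smul]
    have hcont : Continuous fun y ↦ ⅟(2 : R) • (y + ε • s y) := by fun_prop
    rw [← hfix]
    refine map_mem_closure (f := fun y ↦ ⅟(2 : R) • (y + ε • s y)) hcont (hι x) ?_
    rintro _ ⟨v, rfl⟩
    exact ⟨⅟(2 : R) • (v + ε • r v), Submodule.smul_mem _ _ (add_smul_mem_eigenspace hr hε v),
      by simp only [map_smul, map_add, hsι]⟩

end Involution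

theorem rho_mul_rho : rho * rho = 1 := by
  ext ψ w <;> simp [rho, sigma]

theorem rhoL2_toHilbert (ψ : Spinor) : rhoL2 (toHilbert ψ) = toHilbert (rho ψ) := by
  have hsigma (f : 𝓢(ℂ, ℂ)) : sigmaL2 (SchwartzMap.toLpCLM ℂ ℂ 2 MeasureTheory.volume f) =
      SchwartzMap.toLpCLM ℂ ℂ 2 MeasureTheory.volume (sigma f) := rfl
  simp [rhoL2, toHilbert, rho, -SchwartzMap.toLpCLM_apply, hsigma]

theorem continuous_rhoL2 : Continuous rhoL2 := by
  have hsigma : Continuous sigmaL2 := (MeasureTheory.Lp.compMeasurePreservingₗᵢ ℂ Neg.neg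
    (MeasureTheory.Measure.measurePreserving_neg MeasureTheory.volume)).continuous
  have hprod : Continuous fun x : L2 × L2 ↦ (sigmaL2 x.1, -sigmaL2 x.2) := by fun_prop
  exact (WithLp.prod_continuous_toLp 2 L2 L2).comp
    (hprod.comp (WithLp.prod_continuous_ofLp 2 L2 L2))

theorem denseRange_toHilbert : DenseRange toHilbert := by
  have hLp := SchwartzMap.denseRange_toLpCLM (E := ℂ) (F := ℂ) (p := 2)
    (μ := MeasureTheory.volume) ENNReal.ofNat_ne_top
  exact (WithLp.homeomorphProd 2 L2 L2).symm.surjective.denseRange.comp (hLp.prodMap hLp)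
    (WithLp.prod_continuous_toLp 2 L2 L2)

section SchwartzOperators

variable {E F : Type*} [NormedAddCommGroup E] [NormedSpace ℝ E]
  [NormedAddCommGroup F] [NormedSpace ℝ F]

theorem lineDerivOp_lineDerivOp_comm (m n : E) (f : 𝓢(E, F)) :
    ∂_{m} (∂_{n} f) = ∂_{n} (∂_{m} f) := by
  have hiter (m n : E) : ∂_{m} (∂_{n} f) = ∂^{![m, n]} f := by
    simp [iteratedLineDerivOp_succ_left]
  ext x
  rw [hiter, hiter, SchwartzMap.iteratedLineDerivOp_eq_iteratedFDeriv,
    SchwartzMap.iteratedLineDerivOp_eq_iteratedFDeriv]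
  exact IsSymmSndFDerivAt.iteratedFDeriv_cons
    (hf := (f.smooth 2).contDiffAt.isSymmSndFDerivAt (by simp))

theorem lineDerivOp_smulLeftCLM {𝕜 : Type*} [RCLike 𝕜] [NormedSpace 𝕜 F] [IsScalarTower ℝ 𝕜 F]
    (L : E →L[ℝ] 𝕜) (m : E) (f : 𝓢(E, F)) :
    ∂_{m} (SchwartzMap.smulLeftCLM F L f) =
      SchwartzMap.smulLeftCLM F L (∂_{m} f) + L m • f := by
  have hL : Function.HasTemperateGrowth L := L.hasTemperateGrowth
  ext x
  have hprod : HasFDerivAt (fun x ↦ L x • f x) _ x :=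
    L.hasFDerivAt.smul f.differentiableAt.hasFDerivAt
  rw [SchwartzMap.lineDerivOp_apply_eq_fderiv, SchwartzMap.smulLeftCLM_apply hL, hprod.fderiv]
  simp [SchwartzMap.smulLeftCLM_apply_apply hL, SchwartzMap.lineDerivOp_apply_eq_fderiv]

/-- The directional derivative `∂_m` as an endomorphism of the Schwartz space, so that it can enter
commutators with multiplication operators. -/
noncomputable def partialDeriv (m : E) : End ℂ 𝓢(E, ℂ) := (lineDerivOpCLM ℂ 𝓢(E, ℂ) m).toLinearMap

/-- Pointwise (undeformed) multiplication by a real-linear function, as an endomorphism of the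
Schwartz space. -/
noncomputable def pointwiseMul (L : E →L[ℝ] ℂ) : End ℂ 𝓢(E, ℂ) :=
  (SchwartzMap.smulLeftCLM ℂ L).toLinearMap

theorem partialDeriv_lie_partialDeriv (m n : E) : ⁅partialDeriv m, partialDeriv n⁆ = 0 :=
  LinearMap.ext fun f ↦ sub_eq_zero.mpr (lineDerivOp_lineDerivOp_comm m n f)

theorem partialDeriv_lie_pointwiseMul (m : E) (L : E →L[ℝ] ℂ) :
    ⁅partialDeriv m, pointwiseMul L⁆ = L m • 1 :=
  LinearMap.ext fun f ↦ sub_eq_iff_eq_add'.mpr (lineDerivOp_smulLeftCLM L m f)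

theorem pointwiseMul_lie_partialDeriv (L : E →L[ℝ] ℂ) (m : E) :
    ⁅pointwiseMul L, partialDeriv m⁆ = -(L m • 1) := by
  rw [← lie_skew, partialDeriv_lie_pointwiseMul]

theorem pointwiseMul_lie_pointwiseMul (L L' : E →L[ℝ] ℂ) :
    ⁅pointwiseMul L, pointwiseMul L'⁆ = 0 := by
  have hL : Function.HasTemperateGrowth L := L.hasTemperateGrowth
  have hL' : Function.HasTemperateGrowth L' := L'.hasTemperateGrowth
  refine LinearMap.ext fun f ↦ sub_eq_zero.mpr ?_
  simp [pointwiseMul, hL, hL', mul_comm]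

end SchwartzOperators

section MoyalMultiplication

variable (κ : ℝ) (hκ : κ ≠ 0)

theorem leftMul_eq (L : ℂ →L[ℝ] ℂ) :
    leftMul κ hκ L = pointwiseMul L + ((κ : ℂ) / (4 * Complex.I)) •
      (L 1 • partialDeriv Complex.I - L Complex.I • partialDeriv 1) :=
  LinearMap.ext fun f ↦ DFunLike.coe_injective (moyal_linear hκ L f)

theorem partialDeriv_lie_leftMul (m : ℂ) (L : ℂ →L[ℝ] ℂ) :
    ⁅partialDeriv m, leftMul κ hκ L⁆ = L m • 1 := by
  simp only [leftMul_eq, lie_add, lie_sub, lie_smul, partialDeriv_lie_partialDeriv,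
    partialDeriv_lie_pointwiseMul, smul_zero, sub_zero, add_zero]

-- `L 1 * L' I - L I * L' 1` is the Poisson bracket of the linear functions `L` and `L'`.
theorem leftMul_lie_leftMul (L L' : ℂ →L[ℝ] ℂ) :
    ⁅leftMul κ hκ L, leftMul κ hκ L'⁆ =
      ((κ : ℂ) / (2 * Complex.I) * (L 1 * L' Complex.I - L Complex.I * L' 1)) • 1 := by
  rw [leftMul_eq κ hκ L, add_lie, smul_lie, sub_lie, smul_lie, smul_lie,
    partialDeriv_lie_leftMul, partialDeriv_lie_leftMul, leftMul_eq κ hκ L']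
  simp only [lie_add, lie_sub, lie_smul, pointwiseMul_lie_pointwiseMul,
    pointwiseMul_lie_partialDeriv]
  match_scalars
  field_simp
  ring

theorem coordZStar_lie_coordZ : ⁅coordZStar κ hκ, coordZ κ hκ⁆ = (κ : ℂ) • 1 := by
  rw [coordZStar, coordZ, leftMul_lie_leftMul]
  congr 1
  change (κ : ℂ) / (2 * Complex.I) * (conj 1 * Complex.I - conj Complex.I * 1) = κ
  rw [map_one, Complex.conj_I]
  field_simp
  ring

theorem delZ_lie_leftMul (L : ℂ →L[ℝ] ℂ) :
    ⁅delZ, leftMul κ hκ L⁆ = ((L 1 - Complex.I * L Complex.I) / 2) • 1 := by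
  change ⁅(1 / 2 : ℂ) • (partialDeriv 1 - Complex.I • partialDeriv Complex.I), _⁆ = _
  rw [smul_lie, sub_lie, smul_lie, partialDeriv_lie_leftMul, partialDeriv_lie_leftMul]
  module

theorem delZStar_lie_leftMul (L : ℂ →L[ℝ] ℂ) :
    ⁅delZStar, leftMul κ hκ L⁆ = ((L 1 + Complex.I * L Complex.I) / 2) • 1 := by
  change ⁅(1 / 2 : ℂ) • (partialDeriv 1 + Complex.I • partialDeriv Complex.I), _⁆ = _
  rw [smul_lie, add_lie, smul_lie, partialDeriv_lie_leftMul, partialDeriv_lie_leftMul]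
  module

theorem delZ_lie_coordZ : ⁅delZ, coordZ κ hκ⁆ = 1 := by
  simp [coordZ, delZ_lie_leftMul]

theorem delZ_lie_coordZStar : ⁅delZ, coordZStar κ hκ⁆ = 0 := by
  simp [coordZStar, delZ_lie_leftMul]

theorem delZStar_lie_coordZ : ⁅delZStar, coordZ κ hκ⁆ = 0 := by
  simp [coordZ, delZStar_lie_leftMul]

theorem delZStar_lie_coordZStar : ⁅delZStar, coordZStar κ hκ⁆ = 1 := by
  simp [coordZStar, delZStar_lie_leftMul]

end MoyalMultiplication

section QuarticWords

variable {R A : Type*} [CommRing R] [Ring A] [Algebra R A] {κ : R} {Z W : A}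

theorem mul_mul_of_lie_eq_smul_one (h : ⁅W, Z⁆ = κ • 1) (X : A) :
    W * (Z * X) = Z * (W * X) + κ • X := by
  rw [← mul_assoc, sub_eq_iff_eq_add'.mp h, add_mul, smul_one_mul, mul_assoc]

theorem quartic_words_eq_four_mul_sq (h : ⁅W, Z⁆ = κ • 1) :
    -(8 : R) • (Z * W * Z * W) + (6 : R) • (Z * Z * W * W) + (2 : R) • (W * W * Z * Z) =
      (4 * κ ^ 2) • 1 := by
  have hWZ : W * Z = Z * W + κ • 1 := sub_eq_iff_eq_add'.mp h
  simp only [mul_assoc, hWZ, mul_mul_of_lie_eq_smul_one h, mul_add, add_mul, mul_smul_comm,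
    smul_mul_assoc, mul_one, smul_add]
  module

theorem quartic_words_eq_neg_four_mul_sq (h : ⁅W, Z⁆ = κ • 1) :
    -(4 : R) • (W * Z * W * Z) + (6 : R) • (Z * W * W * Z) - (2 : R) • (Z * Z * W * W) =
      -(4 * κ ^ 2) • 1 := by
  have hWZ : W * Z = Z * W + κ • 1 := sub_eq_iff_eq_add'.mp h
  simp only [mul_assoc, hWZ, mul_mul_of_lie_eq_smul_one h, mul_add, add_mul, mul_smul_comm,
    smul_mul_assoc, mul_one, one_mul, smul_add]
  module

end QuarticWords

section OffDiagonal

variable {R M : Type*} [CommRing R] [AddCommGroup M] [Module R M]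

/-- The off-diagonal operator `(0, P; Q, 0)` on `M × M`; the Dirac operator and its commutators
with diagonal operators have this form. -/
def offDiag (P Q : End R M) : End R (M × M) :=
  (P ∘ₗ LinearMap.snd R M M).prod (Q ∘ₗ LinearMap.fst R M M)

variable (P Q S T : End R M)

theorem offDiag_mul_offDiag : offDiag P Q * offDiag S T = LinearMap.prodMap (P * T) (Q * S) := rfl

theorem offDiag_mul_prodMap : offDiag P Q * LinearMap.prodMap S T = offDiag (P * T) (Q * S) := rfl

theorem prodMap_mul_offDiag : LinearMap.prodMap S T * offDiag P Q = offDiag (S * P) (T * Q) := rfl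

theorem offDiag_lie_prodMap_self :
    ⁅offDiag P Q, LinearMap.prodMap T T⁆ = offDiag ⁅P, T⁆ ⁅Q, T⁆ :=
  LinearMap.ext fun _ ↦ rfl

end OffDiagonal

section Orientation

theorem lie_mul {A : Type*} [Ring A] (P Z W : A) : ⁅P, Z * W⁆ = ⁅P, Z⁆ * W + Z * ⁅P, W⁆ := by
  simp only [Ring.lie_def]
  noncomm_ring

variable {R M : Type*} [Field R] [AddCommGroup M] [Module R M]
  {κ : R} {P Q Z W : End R M}

theorem orientation_identity_offDiag (hWZ : ⁅W, Z⁆ = κ • 1) (hPZ : ⁅P, Z⁆ = 1) (hPW : ⁅P, W⁆ = 0)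
    (hQZ : ⁅Q, Z⁆ = 0) (hQW : ⁅Q, W⁆ = 1) {D a b bStar : End R (M × M)}
    (hD : D = offDiag P Q) (ha : a = LinearMap.prodMap (Z * W) (Z * W))
    (hb : b = LinearMap.prodMap (Z * Z) (Z * Z))
    (hbStar : bStar = LinearMap.prodMap (W * W) (W * W)) :
    -(⁅D, bStar⁆ * a * ⁅D, b⁆) - (2 : R) • (a * ⁅D, b⁆ * ⁅D, bStar⁆)
        + (3 / 2 : R) • (a * ⁅D, bStar⁆ * ⁅D, b⁆) + (3 : R) • (b * ⁅D, a⁆ * ⁅D, bStar⁆)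
        - b * ⁅D, bStar⁆ * ⁅D, a⁆ + bStar * ⁅D, b⁆ * ⁅D, a⁆ =
      (4 * κ ^ 2) • LinearMap.prodMap 1 (-1) := by
  have hDa : ⁅D, a⁆ = offDiag W Z := by
    rw [hD, ha, offDiag_lie_prodMap_self, lie_mul, lie_mul, hPZ, hPW, hQZ, hQW]
    simp only [one_mul, mul_one, mul_zero, zero_mul, add_zero, zero_add]
  have hDb : ⁅D, b⁆ = offDiag ((2 : R) • Z) 0 := by
    rw [hD, hb, offDiag_lie_prodMap_self, lie_mul, lie_mul, hPZ, hQZ]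
    simp only [one_mul, mul_one, mul_zero, zero_mul, add_zero, two_smul]
  have hDbStar : ⁅D, bStar⁆ = offDiag 0 ((2 : R) • W) := by
    rw [hD, hbStar, offDiag_lie_prodMap_self, lie_mul, lie_mul, hPW, hQW]
    simp only [one_mul, mul_one, mul_zero, zero_mul, add_zero, two_smul]
  calc
    _ = LinearMap.prodMap
          (-(8 : R) • (Z * W * Z * W) + (6 : R) • (Z * Z * W * W) + (2 : R) • (W * W * Z * Z))
          (-(4 : R) • (W * Z * W * Z) + (6 : R) • (Z * W * W * Z) - (2 : R) • (Z * Z * W * W)) := by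
      rw [hDa, hDb, hDbStar, ha, hb, hbStar]
      simp only [offDiag_mul_offDiag, offDiag_mul_prodMap, prodMap_mul_offDiag]
      refine LinearMap.ext fun ψ ↦ Prod.ext ?_ ?_ <;>
      simp only [LinearMap.add_apply, LinearMap.sub_apply, LinearMap.neg_apply,
        LinearMap.smul_apply, LinearMap.zero_apply, LinearMap.prodMap_apply, Prod.fst_add,
        Prod.fst_sub, Prod.fst_neg, Prod.smul_fst, Prod.snd_add, Prod.snd_sub, Prod.snd_neg,
        Prod.smul_snd, mul_zero, zero_mul, smul_mul_assoc, mul_smul_comm, ← mul_assoc] <;>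
      match_scalars <;> field_simp <;> norm_num
    _ = LinearMap.prodMap ((4 * κ ^ 2) • 1) (-(4 * κ ^ 2) • 1) := by
      rw [quartic_words_eq_four_mul_sq hWZ, quartic_words_eq_neg_four_mul_sq hWZ]
    _ = (4 * κ ^ 2) • LinearMap.prodMap 1 (-1) := by
      rw [neg_smul, ← smul_neg, LinearMap.prodMap_smul]

end Orientation

end MoyalCone

theorem lemma4p3 (κ : ℝ) (hκ : κ ≠ 0) (ε : ℂ) (hε : ε = 1 ∨ ε = -1) :
    ((core ε).map toHilbert).topologicalClosure = hilbert ε ∧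
      -(⁅dirac ε, genBStar κ hκ ε⁆ * genA κ hκ ε * ⁅dirac ε, genB κ hκ ε⁆)
        - (2 : ℂ) • (genA κ hκ ε * ⁅dirac ε, genB κ hκ ε⁆ * ⁅dirac ε, genBStar κ hκ ε⁆)
        + (3 / 2 : ℂ) • (genA κ hκ ε * ⁅dirac ε, genBStar κ hκ ε⁆ * ⁅dirac ε, genB κ hκ ε⁆)
        + (3 : ℂ) • (genB κ hκ ε * ⁅dirac ε, genA κ hκ ε⁆ * ⁅dirac ε, genBStar κ hκ ε⁆)
        - genB κ hκ ε * ⁅dirac ε, genBStar κ hκ ε⁆ * ⁅dirac ε, genA κ hκ ε⁆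
        + genBStar κ hκ ε * ⁅dirac ε, genB κ hκ ε⁆ * ⁅dirac ε, genA κ hκ ε⁆
        = (4 * (κ : ℂ) ^ 2) • chirality ε := by
  refine ⟨topologicalClosure_map_eigenspace rho_mul_rho continuous_rhoL2 denseRange_toHilbert
    rhoL2_toHilbert (mul_self_eq_one_iff.mpr hε), LinearMap.ext fun ψ ↦ Subtype.ext ?_⟩
  have hplane := orientation_identity_offDiag (D := diracPlane) (coordZStar_lie_coordZ κ hκ)
    (delZ_lie_coordZ κ hκ) (delZ_lie_coordZStar κ hκ) (delZStar_lie_coordZ κ hκ)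
    (delZStar_lie_coordZStar κ hκ) rfl rfl rfl rfl
  exact LinearMap.congr_fun hplane (ψ : Spinor)
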